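/- Let $I\subset\mathbb R$ be a non-empty open interval, let $R:I\to(0,\infty)$ be of class $C^2$ with $$2(R')^2-R''R+R^2=0\quad\text{on } I ,$$ and let $c>0$. Let $M=I\times S^3$ be the closed homogeneous and isotropic universe with conformal time $x^0\in I$ and the metric $\mathbf g=R(x^0)^2\big((dx^0)^2-g_{S^3}\big)$, where $S^3\subset\mathbb R^4$ is the unit sphere and $g_{S^3}$ its round metric. In each of the two stereographic charts $x^0,x^1,x^2,x^3$ (from the North Pole $(0,0,0,1)$ and from the South Pole $(0,0,0,-1)$) $$ds^2=R^2(dx^0)^2-\frac{4R^2\big((dx^1)^2+(dx^2)^2+(dx^3)^2\big)}{(|x|^2+1)^2},\qquad |x|^2=(x^1)^2+(x^2)^2+(x^3)^2 .$$ Let $t:I\to\mathbb R$ be a time variable, i.e. $c\,dt=R\,dx^0$. A vector $v$ is time-like if $\mathbf g(v,v)>0$ and space-like if $\mathbf g(v,v)<0$. A Killing field is a smooth vector field $\mathbf X$ on $M$ with $L_{\mathbf X}\mathbf g=0$. Then there are constants $a>0$, $b$ and $t_0$ such that the following holds, where $u^0=c(t-t_0)/a$ and $u^i=x^i$ for $i=1,2,3$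 (so $|u|=|x|$). 1. On $I$ we have $-\pi/2<x^0+b<\pi/2$, $R=\dfrac{a}{\cos(x^0+b)}$ and $R=a\cosh\big(c(t-t_0)/a\big)$. (After a shift of the origins of $x^0$ and $t$: $R=a/\cos x^0$ and $R(t)=a\cosh(ct/a)$.) 2. $M$ has constant sectional curvature $-1/a^2$ (on all nondegenerate tangent planes, in the sign convention $R^p_{qij}=\partial_i\Gamma^p_{jq}-\partial_j\Gamma^p_{iq}+\Gamma^p_{ih}\Gamma^h_{jq}-\Gamma^p_{jh}\Gamma^h_{iq}$, $K(v,w)=\dfrac{\mathbf g(\mathcal R(v,w)w,v)}{\mathbf g(v,v)\mathbf g(w,w)-\mathbf g(v,w)^2}$). 3. The map $F(x^0,y)=(a\sinh u^0,\;a\cosh(u^0)\,y)\in\mathbb R\times\mathbb R^4$ is smooth and injective on $M$, and it is isometric for the metric $(dz^0)^2-(dz^1)^2-(dz^2)^2-(dz^3)^2-(dz^4)^2$ on $\mathbb R^5$. Its image is the part of de Sitter space $\{z:(z^0)^2-(z^1)^2-\dots-(z^4)^2=-a^2\}$ on which $z^0\in a\sinh(u^0(I))$; if $t$ takes all real values,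 the image is the whole of de Sitter space. 4. In the North Pole coordinates $x$, the following six formulas extend to Killing fields on $M$, each of which is space-like wherever it is not zero: $$\tfrac{2(x^k)^2-|x|^2+1}{2}\,\tfrac{\partial}{\partial x^k}+\sum_{j\in\{1,2,3\},\,j\ne k}x^kx^j\tfrac{\partial}{\partial x^j}\quad(k=1,2,3),$$ $$x^2\tfrac{\partial}{\partial x^1}-x^1\tfrac{\partial}{\partial x^2},\qquad x^3\tfrac{\partial}{\partial x^2}-x^2\tfrac{\partial}{\partial x^3},\qquad -x^3\tfrac{\partial}{\partial x^1}+x^1\tfrac{\partial}{\partial x^3}.$$ 5. In the coordinates $u$, the following four formulas also extend to Killing fields on $M$: $$\tfrac{2u^k}{|u|^2+1}\tfrac{\partial}{\partial u^0}+\tfrac{|u|^2-2(u^k)^2+1}{2}\,\tfrac{\sinh u^0}{\cosh u^0}\,\tfrac{\partial}{\partial u^k}-\sum_{j\in\{1,2,3\},\,j\neq k}u^ku^j\,\tfrac{\sinh u^0}{\cosh u^0}\,\tfrac{\partial}{\partial u^j}\quad(k=1,2,3),$$ $$\tfrac{|u|^2-1}{|u|^2+1}\tfrac{\partial}{\partial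 u^0}+\tfrac{\sinh u^0}{\cosh u^0}\Big(u^1\tfrac{\partial}{\partial u^1}+u^2\tfrac{\partial}{\partial u^2}+u^3\tfrac{\partial}{\partial u^3}\Big).$$ Under $dF$ they become, in this order, the infinitesimal hyperbolic rotations $z^k\partial/\partial z^0+z^0\partial/\partial z^k$, $k=1,2,3,4$. 6. The ten Killing fields are linearly independent over $\mathbb R$, and no linear combination of them with constant coefficients is time-like at every point of $M$. -/

import Mathlib

open Real Set
open scoped ContDiff

noncomputable section

namespace ClosedUniverse

/-- Local coordinates `(x⁰, x¹, x², x³)`. -/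
abbrev Coord : Type := Fin 4 → ℝ

/-- `ℝ × ℝ⁴`. It contains the space-time `I × S³` (as pairs of a conformal time and a unit vector),
and it is also the five-dimensional space `(z⁰, (z¹, z², z³, z⁴))` containing de Sitter space. -/
abbrev Ambient : Type := ℝ × EuclideanSpace ℝ (Fin 4)

/-! ### Tensor calculus in a coordinate chart -/

/-- The partial derivative `∂f/∂xⁱ`. -/
def pd (i : Fin 4) (f : Coord → ℝ) (x : Coord) : ℝ :=
  fderiv ℝ f x (Pi.single i 1)

/-- Christoffel symbols `Γᵏᵢⱼ` of the Levi-Civita connection of the metric `G`. -/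
def christoffel (G : Coord → Matrix (Fin 4) (Fin 4) ℝ) (k i j : Fin 4) (x : Coord) : ℝ :=
  ∑ s, (G x)⁻¹ k s / 2 *
    (pd j (fun y => G y i s) x + pd i (fun y => G y s j) x - pd s (fun y => G y i j) x)

/-- Components `Rᵖ_{qij}` of the Riemann curvature tensor of the metric `G`. -/
def riemann (G : Coord → Matrix (Fin 4) (Fin 4) ℝ) (p q i j : Fin 4) (x : Coord) : ℝ :=
  pd i (christoffel G p j q) x - pd j (christoffel G p i q) x
    + ∑ h, (christoffel G p i h x * christoffel G h j q x
      - christoffel G p j h x * christoffel G h i q x)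

/-- `g(v, w)` at the point with coordinates `x`. -/
def pairing (G : Coord → Matrix (Fin 4) (Fin 4) ℝ) (x v w : Coord) : ℝ :=
  ∑ i, ∑ j, G x i j * v i * w j

/-- The vector `ℛ(v, w) w`, with components `Rᵖ_{qij} w^q vⁱ wʲ`. -/
def curvatureVector (G : Coord → Matrix (Fin 4) (Fin 4) ℝ) (x v w : Coord) : Coord :=
  fun p => ∑ q, ∑ i, ∑ j, riemann G p q i j x * w q * v i * w j

/-- The plane spanned by `v` and `w` is nondegenerate for the metric `G` at `x`. -/
def NondegeneratePlane (G : Coord → Matrix (Fin 4) (Fin 4) ℝ) (x v w : Coord) : Prop :=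
  pairing G x v v * pairing G x w w - pairing G x v w ^ 2 ≠ 0

/-- Sectional curvature of the (nondegenerate) plane spanned by `v` and `w`. -/
def sectionalCurvature (G : Coord → Matrix (Fin 4) (Fin 4) ℝ) (x v w : Coord) : ℝ :=
  pairing G x (curvatureVector G x v w) v /
    (pairing G x v v * pairing G x w w - pairing G x v w ^ 2)

/-- Components `(L_Y g)ᵢⱼ` of the Lie derivative of the metric `G` along the field with
components `Y`. -/
def lieDerivMetric (G : Coord → Matrix (Fin 4) (Fin 4) ℝ) (Y : Coord → Coord)
    (i j : Fin 4) (x : Coord) : ℝ :=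
  ∑ s, Y x s * pd s (fun y => G y i j) x
    + ∑ s, G x s j * pd i (fun y => Y y s) x
    + ∑ s, G x i s * pd j (fun y => Y y s) x

/-! ### The space-time -/

/-- `|x|² = (x¹)² + (x²)² + (x³)²`. -/
def normSqSpatial (x : Coord) : ℝ := x 1 ^ 2 + x 2 ^ 2 + x 3 ^ 2

/-- The space-time `I × S³`, where `I` is the range of the conformal time `x⁰`. -/
def spacetime (I : Set ℝ) : Set Ambient :=
  {p | p.1 ∈ I ∧ ‖p.2‖ = 1}

/-- `v` is tangent to `I × S³` at `p`. -/
def IsTangent (p v : Ambient) : Prop := inner ℝ p.2 v.2 = 0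

/-- The metric of the space-time: `R(x⁰)²` times the difference of `(dx⁰)²` and the round metric of
the unit sphere. -/
def metric (R : ℝ → ℝ) (p v w : Ambient) : ℝ :=
  R p.1 ^ 2 * (v.1 * w.1 - inner ℝ v.2 w.2)

/-- The inverse of a stereographic chart: stereographic projection from `(0,0,0,s)`, `s = ±1`. -/
def invStereo (s : ℝ) (x : Coord) : Ambient :=
  (x 0, !₂[2 * x 1 / (normSqSpatial x + 1), 2 * x 2 / (normSqSpatial x + 1),
    2 * x 3 / (normSqSpatial x + 1), s * (normSqSpatial x - 1) / (normSqSpatial x + 1)])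

/-- Parametrization by the North Pole stereographic coordinates. -/
def northParam : Coord → Ambient := invStereo 1

/-- Parametrization by the South Pole stereographic coordinates. -/
def southParam : Coord → Ambient := invStereo (-1)

/-- The two parametrizations that together cover the whole space-time. -/
def params : Set (Coord → Ambient) := {northParam, southParam}

/-- Components `gᵢⱼ = g(∂ᵢφ, ∂ⱼφ)` of the metric of the space-time in the chart with inverse `φ`. -/
def metricComp (R : ℝ → ℝ) (φ : Coord → Ambient) (x : Coord) : Matrix (Fin 4) (Fin 4) ℝ :=
  Matrix.of fun i j =>
    metric R (φ x) (fderiv ℝ φ x (Pi.single i 1)) (fderiv ℝ φ x (Pi.single j 1))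

theorem norm_invStereo (s : ℝ) (hs : s^2 = 1) (x : Coord) : ‖(invStereo s x).2‖ = 1 := by
  have h : (0:ℝ) < normSqSpatial x + 1 := by unfold normSqSpatial; positivity
  rw [EuclideanSpace.norm_eq, Real.sqrt_eq_one]
  simp [invStereo, Fin.sum_univ_four]
  field_simp
  unfold normSqSpatial at *
  linear_combination ((x 1^2+x 2^2+x 3^2-1)^2)*hs

theorem differentiableAt_invStereo (s : ℝ) (x : Coord) : DifferentiableAt ℝ (invStereo s) x := by
  have h (y:Coord): (normSqSpatial y + 1) ≠ 0 := by unfold normSqSpatial; positivity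
  unfold invStereo
  refine DifferentiableAt.prodMk (by fun_prop) ?_
  rw [differentiableAt_euclidean]
  intro i
  have hn : DifferentiableAt ℝ normSqSpatial x := by unfold normSqSpatial; fun_prop
  fin_cases i <;> simp <;> fun_prop (disch := exact h _)

theorem fderiv_invStereo (s : ℝ) (x v : Coord) : 
   fderiv ℝ (invStereo s) x v = (v 0, !₂[ (2*v 1*(normSqSpatial x+1) - 2*x 1*(2*(x 1*v 1+x 2*v 2+x 3*v 3)))/(normSqSpatial x+1)^2,
   (2*v 2*(normSqSpatial x+1) - 2*x 2*(2*(x 1*v 1+x 2*v 2+x 3*v 3)))/(normSqSpatial x+1)^2,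
   (2*v 3*(normSqSpatial x+1) - 2*x 3*(2*(x 1*v 1+x 2*v 2+x 3*v 3)))/(normSqSpatial x+1)^2,
   4*s*(x 1*v 1+x 2*v 2+x 3*v 3)/(normSqSpatial x+1)^2]) := by
  have h : (normSqSpatial x + 1) ≠ 0 := by unfold normSqSpatial; positivity
  have hl : HasDerivAt (fun r : ℝ => x + r • v) v 0 := by
    simpa using ((hasDerivAt_id (0:ℝ)).smul_const v).const_add x
  have h1 := ((differentiableAt_invStereo s x).hasFDerivAt)
  have h2 : HasDerivAt (fun r : ℝ => invStereo s (x + r • v)) (fderiv ℝ (invStereo s) x v) 0 := by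
    refine HasFDerivAt.comp_hasDerivAt (0:ℝ) (l := invStereo s) ?_ hl
    simpa using h1
  refine h2.unique ?_
  have hc (i : Fin 4) : HasDerivAt (fun r : ℝ => (x + r • v) i) (v i) 0 := (hasDerivAt_pi.1 hl) i
  have hn : HasDerivAt (fun r : ℝ => normSqSpatial (x + r • v)) (2*(x 1*v 1+x 2*v 2+x 3*v 3)) 0 := by
    unfold normSqSpatial
    refine ((((hc 1).pow 2).add ((hc 2).pow 2)).add ((hc 3).pow 2)).congr_deriv ?_
    simp
    ring
  have h' : normSqSpatial (x + (0:ℝ) • v) + 1 ≠ 0 := by simpa using h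
  unfold invStereo
  refine HasDerivAt.prodMk (hc 0) ?_
  refine ((PiLp.continuousLinearEquiv 2 ℝ (fun _ : Fin 4 => ℝ)).symm.hasFDerivAt.comp_hasDerivAt (0:ℝ) (f := fun r : ℝ => ![_, _, _, _]) (f' := ![_,_,_,_]) (hasDerivAt_pi.2 ?_))
  intro i
  fin_cases i
  · refine (((hc 1).const_mul 2).div (hn.add_const 1) h').congr_deriv ?_
    simp
  · refine (((hc 2).const_mul 2).div (hn.add_const 1) h').congr_deriv ?_
    simp
  · refine (((hc 3).const_mul 2).div (hn.add_const 1) h').congr_deriv ?_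
    simp
  · refine (((hn.sub_const 1).const_mul s).div (hn.add_const 1) h').congr_deriv ?_
    simp
    ring

/-- In both stereographic charts the metric is
`R² (dx⁰)² - 4 R² ((dx¹)² + (dx²)² + (dx³)²) / (|x|² + 1)²`. -/
theorem metricComp_invStereo (R : ℝ → ℝ) (s : ℝ) (hs : s^2=1) (x : Coord) :
   metricComp R (invStereo s) x = Matrix.diagonal ![R (x 0)^2, -(4*R (x 0)^2/(normSqSpatial x+1)^2),
    -(4*R (x 0)^2/(normSqSpatial x+1)^2), -(4*R (x 0)^2/(normSqSpatial x+1)^2)] := by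
  have h : (normSqSpatial x + 1) ≠ 0 := by unfold normSqSpatial; positivity
  ext i j
  simp only [metricComp, Matrix.of_apply, metric, fderiv_invStereo s]
  rw [PiLp.inner_apply]
  fin_cases i <;> fin_cases j <;> simp [invStereo, Fin.sum_univ_four, -inner_self_eq_norm_sq_to_K] <;>
   field_simp <;> unfold normSqSpatial <;> grind

/-- The space-time has constant sectional curvature `K`. -/
def HasConstantCurvature (I : Set ℝ) (R : ℝ → ℝ) (K : ℝ) : Prop :=
  ∀ φ ∈ params, ∀ x : Coord, x 0 ∈ I → ∀ v w : Coord,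
    NondegeneratePlane (metricComp R φ) x v w →
      sectionalCurvature (metricComp R φ) x v w = K

/-- The vector field `X` on `I × S³` has components `Y` in the chart with inverse `φ`. -/
def HasComponents (I : Set ℝ) (φ : Coord → Ambient) (X : Ambient → Ambient)
    (Y : Coord → Coord) : Prop :=
  ∀ x : Coord, x 0 ∈ I → X (φ x) = fderiv ℝ φ x (Y x)

/-- `X` is a smooth (tangent) vector field on `I × S³` satisfying the Killing equation
`L_X g = 0`. -/
def IsKilling (I : Set ℝ) (R : ℝ → ℝ) (X : Ambient → Ambient) : Prop :=
  ∀ φ ∈ params, ∃ Y : Coord → Coord, ContDiffOn ℝ ∞ Y {x | x 0 ∈ I} ∧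
    HasComponents I φ X Y ∧
    ∀ x : Coord, x 0 ∈ I → ∀ i j, lieDerivMetric (metricComp R φ) Y i j x = 0

/-- The field `X` is time-like at every point of `I × S³`. -/
def IsPurelyTimelike (I : Set ℝ) (R : ℝ → ℝ) (X : Ambient → Ambient) : Prop :=
  ∀ p ∈ spacetime I, 0 < metric R p (X p) (X p)

/-- The field `X` is space-like at every point of `I × S³` at which it does not vanish. -/
def IsSpacelike (I : Set ℝ) (R : ℝ → ℝ) (X : Ambient → Ambient) : Prop :=
  ∀ p ∈ spacetime I, X p ≠ 0 → metric R p (X p) (X p) < 0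

/-! ### De Sitter space -/

/-- The five-dimensional metric `(dz⁰)² - (dz¹)² - (dz²)² - (dz³)² - (dz⁴)²`. -/
def minkowski (v w : Ambient) : ℝ := v.1 * w.1 - inner ℝ v.2 w.2

/-- De Sitter space of radius `a`, a hyperboloid in five-dimensional Minkowski space. -/
def deSitter (a : ℝ) : Set Ambient := {z | minkowski z z = -a ^ 2}

/-- The map `z⁰ = a sinh u⁰`, `(z¹, …, z⁴) = (a cosh u⁰) y`, where `u⁰ = T(x⁰)` and `y ∈ S³`. -/
def toMinkowski (a : ℝ) (T : ℝ → ℝ) (p : Ambient) : Ambient :=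
  (a * sinh (T p.1), (a * cosh (T p.1)) • p.2)

/-- `F` is a smooth injective map from `I × S³` into de Sitter space of radius `a` that preserves
the metrics. -/
structure IsIsometricEmbedding (I : Set ℝ) (R : ℝ → ℝ) (a : ℝ) (F : Ambient → Ambient) : Prop where
  smooth : ContDiffOn ℝ ∞ F (I ×ˢ univ)
  injOn : InjOn F (spacetime I)
  mapsTo : MapsTo F (spacetime I) (deSitter a)
  isometric : ∀ p ∈ spacetime I, ∀ v w : Ambient, IsTangent p v → IsTangent p w →
    minkowski (fderiv ℝ F p v) (fderiv ℝ F p w) = metric R p v w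

/-- The value at `z` of the infinitesimal hyperbolic rotation `zᵏ ∂/∂z⁰ + z⁰ ∂/∂zᵏ`
(the index `k : Fin 4` stands for `z^{k+1}`). -/
def hyperbolicRotation (k : Fin 4) (z : Ambient) : Ambient :=
  (z.2 k, z.1 • EuclideanSpace.single k 1)

/-! ### The ten vector fields in coordinates -/

/-- The time coordinate `u⁰ = c (t - t₀) / a` as a function of `x⁰`. -/
def modifiedTime (c : ℝ) (t : ℝ → ℝ) (a t₀ : ℝ) (x₀ : ℝ) : ℝ := c * (t x₀ - t₀) / a

/-- The coordinates `u⁰ = T(x⁰)`, `uⁱ = xⁱ` as functions of `x`. -/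
def modifiedCoord (T : ℝ → ℝ) (x : Coord) : Coord := ![T (x 0), x 1, x 2, x 3]

/-- The six rotational fields in the coordinates `x`: meridional rotations in the planes
`z¹Oz⁴`, `z²Oz⁴`, `z³Oz⁴`, then equatorial rotations in the planes `z¹Oz²`, `z²Oz³`, `z³Oz¹`. -/
def rotationField : Fin 6 → Coord → Coord :=
  ![fun x => ![0, (2 * x 1 ^ 2 - normSqSpatial x + 1) / 2, x 1 * x 2, x 1 * x 3],
    fun x => ![0, x 2 * x 1, (2 * x 2 ^ 2 - normSqSpatial x + 1) / 2, x 2 * x 3],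
    fun x => ![0, x 3 * x 1, x 3 * x 2, (2 * x 3 ^ 2 - normSqSpatial x + 1) / 2],
    fun x => ![0, x 2, -x 1, 0],
    fun x => ![0, 0, x 3, -x 2],
    fun x => ![0, -x 3, 0, x 1]]

/-- The four fields of hyperbolic rotations in the planes `z¹Oz⁰`, `z²Oz⁰`, `z³Oz⁰`, `z⁴Oz⁰`, in
the coordinates `u`. -/
def hyperbolicField : Fin 4 → Coord → Coord :=
  ![fun u => ![2 * u 1 / (normSqSpatial u + 1),
      (normSqSpatial u - 2 * u 1 ^ 2 + 1) / 2 * (sinh (u 0) / cosh (u 0)),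
      -(u 1 * u 2 * (sinh (u 0) / cosh (u 0))),
      -(u 1 * u 3 * (sinh (u 0) / cosh (u 0)))],
    fun u => ![2 * u 2 / (normSqSpatial u + 1),
      -(u 2 * u 1 * (sinh (u 0) / cosh (u 0))),
      (normSqSpatial u - 2 * u 2 ^ 2 + 1) / 2 * (sinh (u 0) / cosh (u 0)),
      -(u 2 * u 3 * (sinh (u 0) / cosh (u 0)))],
    fun u => ![2 * u 3 / (normSqSpatial u + 1),
      -(u 3 * u 1 * (sinh (u 0) / cosh (u 0))),
      -(u 3 * u 2 * (sinh (u 0) / cosh (u 0))),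
      (normSqSpatial u - 2 * u 3 ^ 2 + 1) / 2 * (sinh (u 0) / cosh (u 0))],
    fun u => ![(normSqSpatial u - 1) / (normSqSpatial u + 1),
      u 1 * (sinh (u 0) / cosh (u 0)),
      u 2 * (sinh (u 0) / cosh (u 0)),
      u 3 * (sinh (u 0) / cosh (u 0))]]

end ClosedUniverse

end

open ClosedUniverse

/-!
The reciprocal `f = 1 / R` satisfies `f'' = -f`, so `R = a / cos (x⁰ + b)`, with the interval in a
single branch of the cosine (`exists_eq_div_cos`). Integrating `c dt = R dx⁰` gives the Gudermannian
relation `sinh u⁰ = tan (x⁰ + b)`, `cosh u⁰ = 1 / cos (x⁰ + b)` (`exists_modifiedTime_eq`), and with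
it everything else becomes explicit in the angle `θ = x⁰ + b`.

The metric is diagonal and has the same components in both stereographic charts. Its logarithmic
derivatives are `tan θ` and `-2 xᵏ / (|x|² + 1)`, so the Christoffel symbols (`christoffel_eq`) and
their derivatives are polynomials in `tan θ`, `x` and `(|x|² + 1)⁻¹`. Comparing components gives
`R^p_{qij} = -(δ^p_i g_{jq} - δ^p_j g_{iq}) / a²` (`riemann_eq`), which is constant curvature
`-1 / a²`.

The map to Minkowski space is `(a tan θ, (a / cos θ) y)`; isometry and the description of the image
follow from `|y| = 1` and `cosh² - sinh² = 1`. The ten fields are given globally on `I × S³` by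
linear formulas in `y`: the rotations `(0, A y)` with `A` in `so(4)`, and the pull-backs of the
hyperbolic rotations, `(cos θ yᵏ, sin θ (eₖ - yᵏ y))` (`rotation`, `boost`). Their components in the
two charts differ at most by a sign, and the Killing equation is checked once for both charts. The
time component of a linear combination is `cos θ` times a linear form in `y`. Such a form vanishes
somewhere on `S³`, and there the combination is not time-like; for the rotations alone the form is
zero, so they are space-like.
-/

namespace ClosedUniverse

/-! ### The scale factor and the time variable -/

/-- The reciprocal `f = 1 / R` turns the equation for `R` into `f'' = -f`; hence
`R = a / cos (x + b)` with the phase `b` chosen so that the interval lies in a single branch. -/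
theorem exists_eq_div_cos {I : Set ℝ} (hI_open : IsOpen I) (hI_conn : I.OrdConnected)
    (hI_ne : I.Nonempty) {R : ℝ → ℝ} (hR : ContDiffOn ℝ 2 R I) (hR_pos : ∀ x ∈ I, 0 < R x)
    (hODE : ∀ x ∈ I, 2 * deriv R x ^ 2 - deriv (deriv R) x * R x + R x ^ 2 = 0) :
    ∃ a b : ℝ, 0 < a ∧ ∀ x ∈ I, x + b ∈ Ioo (-(π / 2)) (π / 2) ∧ R x = a / cos (x + b) := by
  obtain ⟨x₁, hx₁⟩ := hI_ne
  have hR1 : ∀ x ∈ I, HasDerivAt R (deriv R x) x := fun x hx =>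
    ((hR.differentiableOn (by norm_num)).differentiableAt (hI_open.mem_nhds hx)).hasDerivAt
  have hR2 : ∀ x ∈ I, HasDerivAt (deriv R) (deriv (deriv R) x) x := fun x hx => by
    have h : ContDiffOn ℝ 1 (deriv R) I :=
      ((contDiffOn_succ_iff_deriv_of_isOpen (n := 1) hI_open).1
        (by simpa [one_add_one_eq_two] using hR)).2.2
    exact ((h.differentiableOn (by norm_num)).differentiableAt (hI_open.mem_nhds hx)).hasDerivAt
  set f : ℝ → ℝ := fun x => (R x)⁻¹ with hf
  set g : ℝ → ℝ := fun x => -deriv R x / R x ^ 2 with hg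
  have hf1 : ∀ x ∈ I, HasDerivAt f (g x) x := fun x hx => (hR1 x hx).inv (hR_pos x hx).ne'
  have hg1 : ∀ x ∈ I, HasDerivAt g (-f x) x := fun x hx => by
    have h0 := (hR_pos x hx).ne'
    refine ((hR2 x hx).neg.div ((hR1 x hx).pow 2) (pow_ne_zero 2 h0)).congr_deriv ?_
    simp only [hf]
    have := hODE x hx
    field_simp
    simp
    linear_combination R x ^ 2 * this
  -- The pair `(f, f')`, rotated back by the angle `x - x₁`, is constant.
  have hconst : ∀ P : ℝ → ℝ, (∀ x ∈ I, HasDerivAt P 0 x) → ∀ x ∈ I, P x = P x₁ := fun P hP x hx =>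
    hI_conn.convex.is_const_of_fderivWithin_eq_zero (𝕜 := ℝ)
      (fun y hy => (hP y hy).differentiableAt.differentiableWithinAt)
      (fun y hy => by
        rw [fderivWithin_of_isOpen hI_open hy, (hP y hy).hasFDerivAt.fderiv]; simp) hx hx₁
  have hs : ∀ x, HasDerivAt (fun x => sin (x - x₁)) (cos (x - x₁)) x := fun x => by
    simpa using ((hasDerivAt_id x).sub_const x₁).sin
  have hc : ∀ x, HasDerivAt (fun x => cos (x - x₁)) (-sin (x - x₁)) x := fun x => by
    simpa using ((hasDerivAt_id x).sub_const x₁).cos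
  have hsol : ∀ x ∈ I, f x = f x₁ * cos (x - x₁) + g x₁ * sin (x - x₁) := fun x hx => by
    have h1 := hconst (fun x => f x * cos (x - x₁) - g x * sin (x - x₁)) (fun y hy =>
      (((hf1 y hy).mul (hc y)).sub ((hg1 y hy).mul (hs y))).congr_deriv (by ring)) x hx
    have h2 := hconst (fun x => f x * sin (x - x₁) + g x * cos (x - x₁)) (fun y hy =>
      (((hf1 y hy).mul (hs y)).add ((hg1 y hy).mul (hc y))).congr_deriv (by ring)) x hx
    simp only [sub_self, cos_zero, sin_zero] at h1 h2
    linear_combination cos (x - x₁) * h1 + sin (x - x₁) * h2 - f x * sin_sq_add_cos_sq (x - x₁)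
  have hfpos : ∀ x ∈ I, 0 < f x := fun x hx => inv_pos.2 (hR_pos x hx)
  -- Polar form of the initial data: `f x₁ = A cos δ` and `f' x₁ = -A sin δ` with `|δ| < π / 2`.
  set δ : ℝ := -arctan (g x₁ / f x₁) with hδ
  have hδmem : δ ∈ Ioo (-(π / 2)) (π / 2) :=
    ⟨neg_lt_neg (arctan_lt_pi_div_two _), by
      have := neg_pi_div_two_lt_arctan (g x₁ / f x₁); rw [hδ]; linarith⟩
  have hcδ : 0 < cos δ := cos_pos_of_mem_Ioo hδmem
  have hA : 0 < f x₁ / cos δ := div_pos (hfpos x₁ hx₁) hcδ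
  have hgδ : g x₁ = -(f x₁ / cos δ) * sin δ := by
    have h : tan δ = -(g x₁ / f x₁) := by rw [hδ, tan_neg, tan_arctan]
    have h0 := (hfpos x₁ hx₁).ne'
    rw [tan_eq_sin_div_cos] at h
    field_simp at h ⊢
    linear_combination h
  have hcos : ∀ x ∈ I, f x = f x₁ / cos δ * cos (x + (δ - x₁)) := fun x hx => by
    rw [hsol x hx, show x + (δ - x₁) = (x - x₁) + δ by ring, cos_add, hgδ]
    field_simp
    ring
  have hcpos : ∀ x ∈ I, 0 < cos (x + (δ - x₁)) := fun x hx => by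
    have := hfpos x hx
    rw [hcos x hx] at this
    exact (pos_iff_pos_of_mul_pos this).1 hA
  refine ⟨(f x₁ / cos δ)⁻¹, δ - x₁, inv_pos.2 hA, fun x hx => ⟨⟨?_, ?_⟩, ?_⟩⟩
  · by_contra! h
    have := hcpos (-(π / 2) - (δ - x₁)) (hI_conn.out hx hx₁ ⟨by linarith, by linarith [hδmem.1]⟩)
    simp at this
  · by_contra! h
    have := hcpos (π / 2 - (δ - x₁)) (hI_conn.out hx₁ hx ⟨by linarith [hδmem.2], by linarith⟩)
    simp at this
  · have h1 : R x = (f x)⁻¹ := (inv_inv _).symm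
    rw [h1, hcos x hx, mul_inv]
    rfl

theorem cosh_arsinh_tan {x : ℝ} (hx : 0 < cos x) : cosh (arsinh (tan x)) = 1 / cos x := by
  rw [cosh_arsinh, ← inv_sqrt_one_add_tan_sq hx, one_div, inv_inv]

theorem hasDerivAt_arsinh_tan {x : ℝ} (hx : 0 < cos x) :
    HasDerivAt (fun y => arsinh (tan y)) (1 / cos x) x := by
  refine ((hasDerivAt_tan hx.ne').arsinh).congr_deriv ?_
  rw [← cosh_arsinh, cosh_arsinh_tan hx, smul_eq_mul]
  field_simp

/-- For `R = a / cos (x⁰ + b)` the modified time is, for a suitable origin of time, the inverse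
Gudermannian function of `x⁰ + b`. -/
theorem exists_modifiedTime_eq {I : Set ℝ} (hI_open : IsOpen I) (hI_conn : I.OrdConnected)
    (hI_ne : I.Nonempty) {R : ℝ → ℝ} {a b c : ℝ} (ha : 0 < a) (hc : 0 < c)
    (hR : ∀ x ∈ I, x + b ∈ Ioo (-(π / 2)) (π / 2) ∧ R x = a / cos (x + b))
    {t : ℝ → ℝ} (ht : ∀ x ∈ I, HasDerivAt t (R x / c) x) :
    ∃ t₀, ∀ x ∈ I, modifiedTime c t a t₀ x = arsinh (tan (x + b)) := by
  obtain ⟨x₁, hx₁⟩ := hI_ne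
  have hd : ∀ x ∈ I, HasDerivAt (fun x => c * t x / a - arsinh (tan (x + b))) 0 x := fun x hx => by
    have hcx := cos_pos_of_mem_Ioo (hR x hx).1
    refine ((((ht x hx).const_mul c).div_const a).sub
      ((hasDerivAt_arsinh_tan hcx).comp_add_const x b)).congr_deriv ?_
    rw [(hR x hx).2]
    field_simp
    ring
  refine ⟨t x₁ - a / c * arsinh (tan (x₁ + b)), fun x hx => ?_⟩
  have h := hI_conn.convex.is_const_of_fderivWithin_eq_zero (𝕜 := ℝ)
      (fun y hy => (hd y hy).differentiableAt.differentiableWithinAt)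
      (fun y hy => by
        rw [fderivWithin_of_isOpen hI_open hy, (hd y hy).hasFDerivAt.fderiv]; simp) hx hx₁
  simp only [modifiedTime] at h ⊢
  field_simp at h ⊢
  linear_combination h


/-! ### Partial derivatives in a chart -/

/-- `f` is differentiable at `x` with partial derivatives `g`. -/
def HasGradAt (f : Coord → ℝ) (g x : Coord) : Prop :=
  DifferentiableAt ℝ f x ∧ ∀ i, pd i f x = g i

namespace HasGradAt

variable {f f₁ f₂ : Coord → ℝ} {g g₁ g₂ x : Coord}

theorem of_eq (h : HasGradAt f g₁ x) (hg : ∀ i, g₁ i = g₂ i) : HasGradAt f g₂ x :=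
  ⟨h.1, fun i => (h.2 i).trans (hg i)⟩

theorem congr (h : HasGradAt f₁ g x) (he : f₂ =ᶠ[nhds x] f₁) : HasGradAt f₂ g x :=
  ⟨h.1.congr_of_eventuallyEq he, fun i => by rw [← h.2 i, pd, pd, he.fderiv_eq]⟩

theorem const (r : ℝ) (x : Coord) : HasGradAt (fun _ => r) (fun _ => 0) x :=
  ⟨by fun_prop, fun i => by simp [pd]⟩

theorem coord (k : Fin 4) (x : Coord) :
    HasGradAt (fun y => y k) (fun i => if i = k then 1 else 0) x :=
  ⟨by fun_prop, fun i => by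
    have h : HasFDerivAt (fun y : Coord => y k)
      (ContinuousLinearMap.proj (R := ℝ) (φ := fun _ : Fin 4 => ℝ) k) x := hasFDerivAt_apply k x
    rw [pd, h.fderiv]
    simp [Pi.single_apply, eq_comm]⟩

theorem add (h₁ : HasGradAt f₁ g₁ x) (h₂ : HasGradAt f₂ g₂ x) :
    HasGradAt (fun y => f₁ y + f₂ y) (fun i => g₁ i + g₂ i) x :=
  ⟨h₁.1.add h₂.1, fun i => by
    simp only [← h₁.2, ← h₂.2, pd, fderiv_fun_add h₁.1 h₂.1]; rfl⟩

theorem mul (h₁ : HasGradAt f₁ g₁ x) (h₂ : HasGradAt f₂ g₂ x) :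
    HasGradAt (fun y => f₁ y * f₂ y) (fun i => g₁ i * f₂ x + f₁ x * g₂ i) x :=
  ⟨h₁.1.mul h₂.1, fun i => by
    simp only [← h₁.2, ← h₂.2, pd, fderiv_fun_mul h₁.1 h₂.1]
    simp; ring⟩

theorem comp {h : ℝ → ℝ} {h' : ℝ} (hh : HasDerivAt h h' (f x)) (hf : HasGradAt f g x) :
    HasGradAt (fun y => h (f y)) (fun i => h' * g i) x :=
  ⟨(hh.comp_hasFDerivAt x hf.1.hasFDerivAt).differentiableAt, fun i => by
    simp only [← hf.2, pd]
    exact congr($((hh.comp_hasFDerivAt x hf.1.hasFDerivAt).fderiv) (Pi.single i 1))⟩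

theorem neg (h : HasGradAt f g x) : HasGradAt (fun y => -f y) (fun i => -g i) x :=
  ((const (-1) x).mul h).of_eq (fun i => by ring) |>.congr (.of_forall fun y => by ring)

theorem sub (h₁ : HasGradAt f₁ g₁ x) (h₂ : HasGradAt f₂ g₂ x) :
    HasGradAt (fun y => f₁ y - f₂ y) (fun i => g₁ i - g₂ i) x :=
  (h₁.add h₂.neg).of_eq (fun i => by ring) |>.congr (.of_forall fun y => by ring)

theorem inv (h : HasGradAt f g x) (h0 : f x ≠ 0) :
    HasGradAt (fun y => (f y)⁻¹) (fun i => -(f x ^ 2)⁻¹ * g i) x :=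
  h.comp (hasDerivAt_inv h0)

theorem pow (h : HasGradAt f g x) (n : ℕ) :
    HasGradAt (fun y => f y ^ n) (fun i => n * f x ^ (n - 1) * g i) x :=
  h.comp (hasDerivAt_pow n _)

theorem ite (p : Prop) [Decidable p] (h : HasGradAt f g x) :
    HasGradAt (fun y => if p then f y else 0) (fun i => if p then g i else 0) x := by
  split_ifs
  exacts [h, .const 0 x]

/-- A function of the time coordinate alone. -/
theorem time {h : ℝ → ℝ} {h' : ℝ} (hh : HasDerivAt h h' (x 0)) :
    HasGradAt (fun y => h (y 0)) ![h', 0, 0, 0] x :=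
  (comp (f := fun y => y 0) hh (coord 0 x)).of_eq fun i => by fin_cases i <;> simp

end HasGradAt

theorem normSqSpatial_add_one_ne_zero (x : Coord) : normSqSpatial x + 1 ≠ 0 := by
  unfold normSqSpatial; positivity

theorem hasGradAt_normSqSpatial (x : Coord) :
    HasGradAt normSqSpatial ![0, 2 * x 1, 2 * x 2, 2 * x 3] x :=
  ((((HasGradAt.coord 1 x).pow 2).add ((HasGradAt.coord 2 x).pow 2)).add
    ((HasGradAt.coord 3 x).pow 2)).of_eq fun i => by fin_cases i <;> simp

theorem hasGradAt_inv_normSqSpatial_add_one (x : Coord) :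
    HasGradAt (fun y => (normSqSpatial y + 1)⁻¹)
      (fun i => -(normSqSpatial x + 1)⁻¹ ^ 2 * ![0, 2 * x 1, 2 * x 2, 2 * x 3] i) x :=
  (((hasGradAt_normSqSpatial x).add (.const 1 x)).inv (normSqSpatial_add_one_ne_zero x)).of_eq
    fun i => by rw [inv_pow, add_zero]

/-! ### The Levi-Civita connection of the metric with scale factor `a / cos (x⁰ + b)` -/

/-- The diagonal entries of the conformal metric `(dx⁰)² - g_{S³}` in a stereographic chart. -/
noncomputable def conformalDiag (i : Fin 4) (x : Coord) : ℝ :=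
  if i = 0 then 1 else -(4 * (normSqSpatial x + 1)⁻¹ ^ 2)

/-- Half of the logarithmic derivative `∂ₖ log |gᵢᵢ|`, where the scale factor contributes its
logarithmic derivative `tan (x⁰ + b)`. -/
noncomputable def halfLogDeriv (b : ℝ) (i k : Fin 4) (x : Coord) : ℝ :=
  if k = 0 then tan (x 0 + b) else if i = 0 then 0 else -(2 * x k) * (normSqSpatial x + 1)⁻¹

/-- Half of `∂ₖ gᵢᵢ` divided by `gₖₖ`; it differs from `halfLogDeriv` only
for a spatial `i` and the time index `k = 0`. -/
noncomputable def halfDerivRatio (b : ℝ) (i k : Fin 4) (x : Coord) : ℝ :=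
  if k = 0 then
    if i = 0 then tan (x 0 + b) else -(4 * tan (x 0 + b)) * (normSqSpatial x + 1)⁻¹ ^ 2
  else if i = 0 then 0 else -(2 * x k) * (normSqSpatial x + 1)⁻¹

/-- The Christoffel symbols `Γᵏᵢⱼ` of the diagonal metric in terms of the logarithmic derivatives
of its entries. -/
noncomputable def christoffelDiag (b : ℝ) (k i j : Fin 4) (x : Coord) : ℝ :=
  (if i = k then halfLogDeriv b k j x else 0) + (if j = k then halfLogDeriv b k i x else 0)
    - if i = j then halfDerivRatio b i k x else 0

theorem exists_eq_invStereo_of_mem_params {φ : Coord → Ambient} (hφ : φ ∈ params) :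
    ∃ s : ℝ, s ^ 2 = 1 ∧ φ = invStereo s := by
  rcases hφ with rfl | rfl
  exacts [⟨1, by norm_num, rfl⟩, ⟨-1, by norm_num, rfl⟩]

section

variable {I : Set ℝ} {R : ℝ → ℝ} {a b s : ℝ} {x : Coord}

theorem metricComp_eq_ite (R : ℝ → ℝ) (hs : s ^ 2 = 1) (x : Coord) (i j : Fin 4) :
    metricComp R (invStereo s) x i j = if i = j then R (x 0) ^ 2 * conformalDiag i x else 0 := by
  rw [metricComp_invStereo R s hs]
  fin_cases i <;> fin_cases j <;> simp [conformalDiag]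
  all_goals ring

theorem eventually_time_mem (hI : IsOpen I) (hx : x 0 ∈ I) : ∀ᶠ y : Coord in nhds x, y 0 ∈ I :=
  (continuous_apply 0).continuousAt.eventually (hI.mem_nhds hx)

/-- The logarithmic derivative of the scale factor is `tan (x⁰ + b)`. -/
theorem hasDerivAt_scale (hI : IsOpen I) (hR : ∀ r ∈ I, 0 < cos (r + b) ∧ R r = a / cos (r + b))
    {r : ℝ} (hr : r ∈ I) : HasDerivAt R (R r * tan (r + b)) r := by
  have h0 := (hR r hr).1.ne'
  have hc : HasDerivAt (fun r => cos (r + b)) (-sin (r + b)) r :=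
    (hasDerivAt_cos (r + b)).comp_add_const r b
  have h := ((hasDerivAt_const r a).div hc h0).congr_of_eventuallyEq (f₁ := R)
    ((hI.eventually_mem hr).mono fun y hy => (hR y hy).2)
  refine h.congr_deriv ?_
  rw [(hR r hr).2, tan_eq_sin_div_cos]
  field_simp
  ring

theorem hasGradAt_metricComp (hI : IsOpen I)
    (hR : ∀ r ∈ I, 0 < cos (r + b) ∧ R r = a / cos (r + b)) (hs : s ^ 2 = 1) (hx : x 0 ∈ I)
    (i j : Fin 4) :
    HasGradAt (fun y => metricComp R (invStereo s) y i j)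
      (fun k => if i = j then R (x 0) ^ 2 * (2 * conformalDiag i x * halfLogDeriv b i k x) else 0)
      x := by
  simp only [metricComp_eq_ite R hs]
  by_cases hij : i = j
  · simp only [hij, if_true]
    have h1 : HasGradAt (fun y => conformalDiag j y)
        (fun k => if k = 0 then 0 else 2 * conformalDiag j x * halfLogDeriv b j k x) x := by
      by_cases hj : j = 0
      · simp only [conformalDiag, halfLogDeriv, hj, if_true]
        exact (HasGradAt.const 1 x).of_eq fun k => by split_ifs <;> simp
      · simp only [conformalDiag, halfLogDeriv, hj, if_false]
        refine ((((hasGradAt_inv_normSqSpatial_add_one x).pow 2).mul (.const (-4) x)).of_eq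
          fun k => ?_).congr (.of_forall fun y => by simp only []; ring)
        fin_cases k <;> simp [-inv_pow]
        all_goals ring
    refine ((((HasGradAt.time (hasDerivAt_scale hI hR hx)).pow 2).mul h1)).of_eq fun k => ?_
    fin_cases k <;> simp [halfLogDeriv]
    all_goals ring
  · simp only [hij, if_false]
    exact .const 0 x

theorem conformalDiag_ne_zero (i : Fin 4) (x : Coord) : conformalDiag i x ≠ 0 := by
  have := normSqSpatial_add_one_ne_zero x
  unfold conformalDiag
  split_ifs
  · exact one_ne_zero
  · exact neg_ne_zero.2 (mul_ne_zero four_ne_zero (pow_ne_zero 2 (inv_ne_zero this)))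

theorem metricComp_inv_eq_ite (hs : s ^ 2 = 1) (hR0 : R (x 0) ≠ 0) (i j : Fin 4) :
    (metricComp R (invStereo s) x)⁻¹ i j
      = if i = j then (R (x 0) ^ 2 * conformalDiag i x)⁻¹ else 0 := by
  have h : metricComp R (invStereo s) x
      = Matrix.diagonal fun i => R (x 0) ^ 2 * conformalDiag i x := by
    ext i j; rw [metricComp_eq_ite R hs, Matrix.diagonal_apply]
  rw [h, Matrix.inv_eq_right_inv (B := .diagonal fun i => (R (x 0) ^ 2 * conformalDiag i x)⁻¹),
    Matrix.diagonal_apply]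
  rw [Matrix.diagonal_mul_diagonal, ← Matrix.diagonal_one]
  congr 1
  ext i
  exact mul_inv_cancel₀ (mul_ne_zero (pow_ne_zero 2 hR0) (conformalDiag_ne_zero i x))

theorem conformalDiag_mul_halfLogDeriv (b : ℝ) (i k : Fin 4) (x : Coord) :
    conformalDiag i x * halfLogDeriv b i k x = conformalDiag k x * halfDerivRatio b i k x := by
  unfold conformalDiag halfLogDeriv halfDerivRatio
  split_ifs <;> ring

theorem scale_ne_zero (ha : a ≠ 0) (hR : ∀ r ∈ I, 0 < cos (r + b) ∧ R r = a / cos (r + b))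
    {r : ℝ} (hr : r ∈ I) : R r ≠ 0 := by
  rw [(hR r hr).2]
  exact div_ne_zero ha (hR r hr).1.ne'

/-- The scale factor cancels from the Christoffel symbols up to its logarithmic derivative
`tan (x⁰ + b)`, so that they are explicit functions independent of `a`. -/
theorem christoffel_eq (hI : IsOpen I) (ha : a ≠ 0)
    (hR : ∀ r ∈ I, 0 < cos (r + b) ∧ R r = a / cos (r + b)) (hs : s ^ 2 = 1) (hx : x 0 ∈ I)
    (k i j : Fin 4) :
    christoffel (metricComp R (invStereo s)) k i j x = christoffelDiag b k i j x := by
  have hR0 := scale_ne_zero ha hR hx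
  have hk := conformalDiag_ne_zero k x
  have h (i j l : Fin 4) := (hasGradAt_metricComp hI hR hs hx i j).2 l
  simp only [christoffel, h, metricComp_inv_eq_ite hs hR0]
  rw [Finset.sum_eq_single k (fun l _ hl => by simp [hl.symm]) (by simp)]
  have h1 := conformalDiag_mul_halfLogDeriv b i k x
  have h2 : (if i = k then R (x 0) ^ 2 * (2 * conformalDiag i x * halfLogDeriv b i j x) else 0)
      = R (x 0) ^ 2 * (2 * conformalDiag k x) * if i = k then halfLogDeriv b k j x else 0 := by
    split_ifs with h
    · subst h; ring
    · ring
  have h3 : (if k = j then R (x 0) ^ 2 * (2 * conformalDiag k x * halfLogDeriv b k i x) else 0)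
      = R (x 0) ^ 2 * (2 * conformalDiag k x) * if j = k then halfLogDeriv b k i x else 0 := by
    simp only [eq_comm (a := k)]
    split_ifs <;> ring
  have h4 : (if i = j then R (x 0) ^ 2 * (2 * conformalDiag i x * halfLogDeriv b i k x) else 0)
      = R (x 0) ^ 2 * (2 * conformalDiag k x) * if i = j then halfDerivRatio b i k x else 0 := by
    split_ifs
    · linear_combination 2 * R (x 0) ^ 2 * h1
    · ring
  rw [h2, h3, h4, if_pos rfl, christoffelDiag]
  field_simp

theorem hasGradAt_tan_time (hx : cos (x 0 + b) ≠ 0) :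
    HasGradAt (fun y => tan (y 0 + b)) ![1 + tan (x 0 + b) ^ 2, 0, 0, 0] x := by
  refine HasGradAt.time (((hasDerivAt_tan hx).comp_add_const (x 0) b).congr_deriv ?_)
  rw [tan_eq_sin_div_cos]
  field_simp
  linear_combination -sin_sq_add_cos_sq (x 0 + b)

/-- The second derivatives of `-log (|x|² + 1)` in the spatial coordinates. -/
theorem hasGradAt_logConformal (k : Fin 4) (x : Coord) :
    HasGradAt (fun y => -(2 * y k) * (normSqSpatial y + 1)⁻¹)
      (fun l => (if l = k then -2 * (normSqSpatial x + 1)⁻¹ else 0)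
          + if l = 0 then 0 else 4 * x k * x l * (normSqSpatial x + 1)⁻¹ ^ 2) x := by
  refine ((((HasGradAt.const 2 x).mul (HasGradAt.coord k x)).neg).mul
    (hasGradAt_inv_normSqSpatial_add_one x)).of_eq fun l => ?_
  fin_cases l <;> simp [-inv_pow] <;> split_ifs <;> ring

theorem hasGradAt_halfLogDeriv (hx : cos (x 0 + b) ≠ 0) (i k : Fin 4) :
    HasGradAt (halfLogDeriv b i k)
      (fun l => if k = 0 then ![1 + tan (x 0 + b) ^ 2, 0, 0, 0] l else if i = 0 then 0
        else (if l = k then -2 * (normSqSpatial x + 1)⁻¹ else 0)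
          + if l = 0 then 0 else 4 * x k * x l * (normSqSpatial x + 1)⁻¹ ^ 2) x := by
  unfold halfLogDeriv
  split_ifs
  · exact hasGradAt_tan_time hx
  · exact .const 0 x
  · exact hasGradAt_logConformal k x

theorem hasGradAt_halfDerivRatio (hx : cos (x 0 + b) ≠ 0) (i k : Fin 4) :
    HasGradAt (halfDerivRatio b i k)
      (fun l => if k = 0 then
          if i = 0 then ![1 + tan (x 0 + b) ^ 2, 0, 0, 0] l
          else if l = 0 then -(4 * (1 + tan (x 0 + b) ^ 2)) * (normSqSpatial x + 1)⁻¹ ^ 2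
            else 16 * tan (x 0 + b) * x l * (normSqSpatial x + 1)⁻¹ ^ 3
        else if i = 0 then 0
        else (if l = k then -2 * (normSqSpatial x + 1)⁻¹ else 0)
          + if l = 0 then 0 else 4 * x k * x l * (normSqSpatial x + 1)⁻¹ ^ 2) x := by
  unfold halfDerivRatio
  split_ifs
  · exact hasGradAt_tan_time hx
  · refine ((((HasGradAt.const 4 x).mul (hasGradAt_tan_time hx)).neg).mul
      ((hasGradAt_inv_normSqSpatial_add_one x).pow 2)).of_eq fun l => ?_
    fin_cases l <;> simp [-inv_pow] <;> ring
  · exact .const 0 x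
  · exact hasGradAt_logConformal k x

/-- The partial derivatives of the Christoffel symbols. -/
theorem hasGradAt_christoffel (hI : IsOpen I) (ha : a ≠ 0)
    (hR : ∀ r ∈ I, 0 < cos (r + b) ∧ R r = a / cos (r + b)) (hs : s ^ 2 = 1) (hx : x 0 ∈ I)
    (k i j : Fin 4) :
    HasGradAt (christoffel (metricComp R (invStereo s)) k i j)
      (fun l => (if i = k then pd l (halfLogDeriv b k j) x else 0)
        + (if j = k then pd l (halfLogDeriv b k i) x else 0)
        - if i = j then pd l (halfDerivRatio b i k) x else 0) x := by
  have hc := (hR _ hx).1.ne'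
  have hpd {f : Coord → ℝ} (h : DifferentiableAt ℝ f x) (p : Prop) [Decidable p] :=
    HasGradAt.ite (g := fun l => pd l f x) p ⟨h, fun _ => rfl⟩
  exact (((hpd (hasGradAt_halfLogDeriv hc k j).1 _).add
    (hpd (hasGradAt_halfLogDeriv hc k i).1 _)).sub
    (hpd (hasGradAt_halfDerivRatio hc i k).1 _)).congr
    ((eventually_time_mem hI hx).mono fun y hy => christoffel_eq hI ha hR hs hy k i j)

set_option maxHeartbeats 4000000 in
/-- The curvature tensor of a space of constant curvature `-1 / a²`; the metric divided by `a²` has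
the diagonal entries `(1 + tan² (x⁰ + b)) * conformalDiag`. -/
theorem riemann_eq (hI : IsOpen I) (ha : a ≠ 0)
    (hR : ∀ r ∈ I, 0 < cos (r + b) ∧ R r = a / cos (r + b)) (hs : s ^ 2 = 1) (hx : x 0 ∈ I)
    (p q i j : Fin 4) :
    riemann (metricComp R (invStereo s)) p q i j x
      = -(1 + tan (x 0 + b) ^ 2) *
        ((if p = i then if j = q then conformalDiag q x else 0 else 0)
          - if p = j then if i = q then conformalDiag q x else 0 else 0) := by
  have hc := (hR _ hx).1.ne'
  simp only [riemann, (hasGradAt_christoffel hI ha hR hs hx _ _ _).2,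
    (hasGradAt_halfLogDeriv hc _ _).2, (hasGradAt_halfDerivRatio hc _ _).2,
    christoffel_eq hI ha hR hs hx, christoffelDiag, halfLogDeriv, halfDerivRatio, conformalDiag,
    Fin.sum_univ_four]
  have hN : (normSqSpatial x + 1)⁻¹ * (x 1 ^ 2 + x 2 ^ 2 + x 3 ^ 2 + 1) = 1 :=
    inv_mul_cancel₀ (normSqSpatial_add_one_ne_zero x)
  generalize (normSqSpatial x + 1)⁻¹ = N at hN ⊢
  generalize tan (x 0 + b) = τ
  -- Each component is a polynomial identity in `τ`, `x` and `N` modulo the relation `hN`.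
  fin_cases p <;> fin_cases q <;> fin_cases i <;> fin_cases j <;>
    simp <;> first | ring1 | grind

theorem hasConstantCurvature (hI : IsOpen I) (ha : a ≠ 0)
    (hR : ∀ r ∈ I, 0 < cos (r + b) ∧ R r = a / cos (r + b)) :
    HasConstantCurvature I R (-1 / a ^ 2) := by
  intro φ hφ x hx v w hvw
  obtain ⟨s, hs, rfl⟩ := exists_eq_invStereo_of_mem_params hφ
  have hc := (hR _ hx).1.ne'
  rw [sectionalCurvature, div_eq_iff hvw]
  have hτ : R (x 0) ^ 2 = a ^ 2 * (1 + tan (x 0 + b) ^ 2) := by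
    rw [(hR _ hx).2, tan_eq_sin_div_cos]
    field_simp
    linear_combination -sin_sq_add_cos_sq (x 0 + b)
  simp only [pairing, curvatureVector, riemann_eq hI ha hR hs hx, metricComp_eq_ite R hs, hτ,
    Fin.sum_univ_four]
  simp
  field_simp
  ring

end

/-! ### The Killing equation in a chart -/

section

variable {I : Set ℝ} {R : ℝ → ℝ} {a b s : ℝ} {x : Coord}

/-- The Killing equation for a field `Y` whose components have the partial derivatives `D`,
with the common factor `R ^ 2` cancelled. -/
theorem lieDerivMetric_eq_zero (hI : IsOpen I)
    (hR : ∀ r ∈ I, 0 < cos (r + b) ∧ R r = a / cos (r + b)) (hs : s ^ 2 = 1) (hx : x 0 ∈ I)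
    {Y : Coord → Coord} {D : Fin 4 → Coord} (hY : ∀ l, HasGradAt (fun y => Y y l) (D l) x)
    (hD : ∀ i j, (if i = j then 2 * conformalDiag i x * ∑ l, Y x l * halfLogDeriv b i l x else 0)
      + conformalDiag j x * D j i + conformalDiag i x * D i j = 0) (i j : Fin 4) :
    lieDerivMetric (metricComp R (invStereo s)) Y i j x = 0 := by
  have h (l : Fin 4) := (hasGradAt_metricComp hI hR hs hx i j).2 l
  simp only [lieDerivMetric, h]
  simp only [metricComp_eq_ite R hs, (hY _).2]
  rw [Finset.sum_eq_single (f := fun l => (if l = j then _ else _) * _) j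
      (fun l _ hl => by simp [hl]) (by simp),
    Finset.sum_eq_single (f := fun l => (if i = l then _ else _) * _) i
      (fun l _ hl => by simp [hl.symm]) (by simp)]
  refine Eq.trans ?_ ((congrArg (R (x 0) ^ 2 * ·) (hD i j)).trans (mul_zero _))
  by_cases hij : i = j
  · simp only [hij, if_true, Finset.mul_sum, mul_add]
    congr 1
    · congr 1
      · exact Finset.sum_congr rfl fun l _ => by ring
      · ring
    · ring
  · simp only [hij, if_true, if_false, mul_zero, Finset.sum_const_zero]
    ring

/-- No differentiability of `Y` is required: scaling by `σ` commutes with `fderiv` also where the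
latter takes its default value. -/
theorem lieDerivMetric_const_smul (G : Coord → Matrix (Fin 4) (Fin 4) ℝ) (σ : ℝ)
    (Y : Coord → Coord) (i j : Fin 4) (x : Coord) :
    lieDerivMetric G (fun y => σ • Y y) i j x = σ * lieDerivMetric G Y i j x := by
  have h (i l : Fin 4) : pd i (fun y => (σ • Y y) l) x = σ * pd i (fun y => Y y l) x := by
    simp only [pd, Pi.smul_apply, smul_eq_mul]
    exact congr($(fderiv_const_smul_field (𝕜 := ℝ) (f := fun y => Y y l) σ) x (Pi.single i 1))
  simp only [lieDerivMetric, h, mul_add, Finset.mul_sum]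
  refine congr_arg₂ _ (congr_arg₂ _ ?_ ?_) ?_ <;>
    exact Finset.sum_congr rfl fun l _ => by
      first | ring1 | (rw [Pi.smul_apply, smul_eq_mul]; ring1)

/-! ### Components of the ten fields in the two charts -/

/-- The rotation in the plane of `z⁴` and `z^{m+1}`, in the North Pole chart. -/
noncomputable def meridionalField (m : Fin 3) (x : Coord) : Coord := fun j =>
  if j = 0 then 0 else x m.succ * x j + if j = m.succ then (1 - normSqSpatial x) * (1 / 2) else 0

/-- The rotation in the plane of the `p`-th and `q`-th spatial coordinates. -/
def equatorialField (p q : Fin 3) (x : Coord) : Coord := fun j =>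
  (if j = p.succ then x q.succ else 0) - if j = q.succ then x p.succ else 0

/-- The hyperbolic rotation in the plane of `z⁰` and `z^{m+1}`, in the coordinates `x`. -/
noncomputable def boostField (b : ℝ) (m : Fin 3) (x : Coord) : Coord := fun j =>
  if j = 0 then cos (x 0 + b) * (2 * x m.succ * (normSqSpatial x + 1)⁻¹)
  else sin (x 0 + b) *
    ((if j = m.succ then (normSqSpatial x + 1) * (1 / 2) else 0) - x m.succ * x j)

/-- The hyperbolic rotation in the plane of `z⁰` and `z⁴`, in the North Pole coordinates `x`. -/
noncomputable def radialBoostField (b : ℝ) (x : Coord) : Coord := fun j =>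
  if j = 0 then cos (x 0 + b) * (1 - 2 * (normSqSpatial x + 1)⁻¹) else sin (x 0 + b) * x j

theorem hasGradAt_cos_time (b : ℝ) (x : Coord) :
    HasGradAt (fun y => cos (y 0 + b)) ![-sin (x 0 + b), 0, 0, 0] x :=
  .time ((hasDerivAt_cos (x 0 + b)).comp_add_const (x 0) b)

theorem hasGradAt_sin_time (b : ℝ) (x : Coord) :
    HasGradAt (fun y => sin (y 0 + b)) ![cos (x 0 + b), 0, 0, 0] x :=
  .time ((hasDerivAt_sin (x 0 + b)).comp_add_const (x 0) b)

set_option maxHeartbeats 1000000 in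
theorem lieDerivMetric_meridionalField (hI : IsOpen I)
    (hR : ∀ r ∈ I, 0 < cos (r + b) ∧ R r = a / cos (r + b)) (hs : s ^ 2 = 1) (hx : x 0 ∈ I)
    (m : Fin 3) (i j : Fin 4) :
    lieDerivMetric (metricComp R (invStereo s)) (meridionalField m) i j x = 0 := by
  have hY (l : Fin 4) := HasGradAt.congr (f₂ := fun y => meridionalField m y l)
    (HasGradAt.ite (¬ l = 0) (((HasGradAt.coord m.succ x).mul (.coord l x)).add
      ((((HasGradAt.const 1 x).sub (hasGradAt_normSqSpatial x)).mul (.const (1 / 2) x)).ite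
        (l = m.succ)))) (.of_forall fun y => by
        simp [meridionalField, ite_not])
  refine lieDerivMetric_eq_zero hI hR hs hx hY (fun i j => ?_) i j
  have hN : (normSqSpatial x + 1)⁻¹ * (normSqSpatial x + 1) = 1 :=
    inv_mul_cancel₀ (normSqSpatial_add_one_ne_zero x)
  simp only [conformalDiag, halfLogDeriv, meridionalField, Fin.sum_univ_four]
  generalize (normSqSpatial x + 1)⁻¹ = N at hN ⊢
  unfold normSqSpatial at *
  fin_cases m <;> fin_cases i <;> fin_cases j <;> simp <;> first | ring1 | grind

set_option maxHeartbeats 1000000 in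
theorem lieDerivMetric_equatorialField (hI : IsOpen I)
    (hR : ∀ r ∈ I, 0 < cos (r + b) ∧ R r = a / cos (r + b)) (hs : s ^ 2 = 1) (hx : x 0 ∈ I)
    (p q : Fin 3) (i j : Fin 4) :
    lieDerivMetric (metricComp R (invStereo s)) (equatorialField p q) i j x = 0 := by
  have hY (l : Fin 4) : HasGradAt (fun y => equatorialField p q y l) _ x :=
    ((HasGradAt.coord q.succ x).ite (l = p.succ)).sub ((HasGradAt.coord p.succ x).ite (l = q.succ))
  refine lieDerivMetric_eq_zero hI hR hs hx hY (fun i j => ?_) i j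
  simp only [conformalDiag, halfLogDeriv, equatorialField, Fin.sum_univ_four]
  fin_cases p <;> fin_cases q <;> fin_cases i <;> fin_cases j <;> simp <;> first | ring1 | grind

set_option maxHeartbeats 1000000 in
theorem lieDerivMetric_boostField (hI : IsOpen I)
    (hR : ∀ r ∈ I, 0 < cos (r + b) ∧ R r = a / cos (r + b)) (hs : s ^ 2 = 1) (hx : x 0 ∈ I)
    (m : Fin 3) (i j : Fin 4) :
    lieDerivMetric (metricComp R (invStereo s)) (boostField b m) i j x = 0 := by
  have hY (l : Fin 4) := HasGradAt.congr (f₂ := fun y => boostField b m y l)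
    ((((hasGradAt_cos_time b x).mul (((HasGradAt.const 2 x).mul (.coord m.succ x)).mul
        (hasGradAt_inv_normSqSpatial_add_one x))).ite (l = 0)).add
      (((hasGradAt_sin_time b x).mul
        (((((hasGradAt_normSqSpatial x).add (.const 1 x)).mul (.const (1 / 2) x)).ite
          (l = m.succ)).sub ((HasGradAt.coord m.succ x).mul (.coord l x)))).ite (¬ l = 0)))
      (.of_forall fun y => by
        simp only [boostField, ite_not]
        split_ifs <;> ring)
  refine lieDerivMetric_eq_zero hI hR hs hx hY (fun i j => ?_) i j
  have hN : (normSqSpatial x + 1)⁻¹ * (normSqSpatial x + 1) = 1 :=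
    inv_mul_cancel₀ (normSqSpatial_add_one_ne_zero x)
  have hτ : cos (x 0 + b) * tan (x 0 + b) = sin (x 0 + b) :=
    mul_comm (tan _) _ ▸ tan_mul_cos (hR _ hx).1.ne'
  simp only [conformalDiag, halfLogDeriv, boostField, Fin.sum_univ_four]
  generalize (normSqSpatial x + 1)⁻¹ = N at hN ⊢
  generalize tan (x 0 + b) = τ at hτ ⊢
  unfold normSqSpatial at *
  fin_cases m <;> fin_cases i <;> fin_cases j <;> simp <;> first | ring1 | grind

set_option maxHeartbeats 1000000 in
theorem lieDerivMetric_radialBoostField (hI : IsOpen I)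
    (hR : ∀ r ∈ I, 0 < cos (r + b) ∧ R r = a / cos (r + b)) (hs : s ^ 2 = 1) (hx : x 0 ∈ I)
    (i j : Fin 4) :
    lieDerivMetric (metricComp R (invStereo s)) (radialBoostField b) i j x = 0 := by
  have hY (l : Fin 4) := HasGradAt.congr (f₂ := fun y => radialBoostField b y l)
    ((((hasGradAt_cos_time b x).mul ((HasGradAt.const 1 x).sub ((HasGradAt.const 2 x).mul
        (hasGradAt_inv_normSqSpatial_add_one x)))).ite (l = 0)).add
      (((hasGradAt_sin_time b x).mul (.coord l x)).ite (¬ l = 0)))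
      (.of_forall fun y => by
        simp only [radialBoostField, ite_not]
        split_ifs <;> ring)
  refine lieDerivMetric_eq_zero hI hR hs hx hY (fun i j => ?_) i j
  have hN : (normSqSpatial x + 1)⁻¹ * (normSqSpatial x + 1) = 1 :=
    inv_mul_cancel₀ (normSqSpatial_add_one_ne_zero x)
  have hτ : cos (x 0 + b) * tan (x 0 + b) = sin (x 0 + b) :=
    mul_comm (tan _) _ ▸ tan_mul_cos (hR _ hx).1.ne'
  simp only [conformalDiag, halfLogDeriv, radialBoostField, Fin.sum_univ_four]
  generalize (normSqSpatial x + 1)⁻¹ = N at hN ⊢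
  generalize tan (x 0 + b) = τ at hτ ⊢
  unfold normSqSpatial at *
  fin_cases i <;> fin_cases j <;> simp <;> first | ring1 | grind

end

/-! ### The ten fields on the space-time -/

/-- The infinitesimal rotation `z^{q+1} ∂/∂z^{p+1} - z^{p+1} ∂/∂z^{q+1}`, tangent to the spheres
`{x⁰} × S³`. -/
noncomputable def rotation (p q : Fin 4) (z : Ambient) : Ambient :=
  (0, z.2 q • EuclideanSpace.single p 1 - z.2 p • EuclideanSpace.single q 1)

/-- The pull-back to `I × S³` of the infinitesimal hyperbolic rotation in the plane of `z⁰` and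
`z^{k+1}`: with `θ = x⁰ + b` it is `cos θ yᵏ ∂/∂x⁰` plus `sin θ` times the gradient of `yᵏ` on the
sphere. -/
noncomputable def boost (b : ℝ) (k : Fin 4) (z : Ambient) : Ambient :=
  (cos (z.1 + b) * z.2 k, sin (z.1 + b) • (EuclideanSpace.single k 1 - z.2 k • z.2))

/-- The six rotations, in the order of `rotationField`. -/
noncomputable def rotations : Fin 6 → Ambient → Ambient :=
  ![rotation 3 0, rotation 3 1, rotation 3 2, rotation 0 1, rotation 1 2, rotation 2 0]

section

variable {I : Set ℝ} {R : ℝ → ℝ} {a b s : ℝ} {x : Coord}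

/-- The sign `s` appears because the two charts see the axis `z⁴` with opposite orientations. -/
theorem rotation_meridional (hs : s ^ 2 = 1) (m : Fin 3) (x : Coord) :
    rotation 3 m.castSucc (invStereo s x)
      = fderiv ℝ (invStereo s) x (s • meridionalField m x) := by
  have hN := normSqSpatial_add_one_ne_zero x
  rw [fderiv_invStereo]
  refine Prod.ext (by simp [rotation, meridionalField]) ?_
  ext l
  rcases (eq_or_eq_neg_of_sq_eq_sq s 1 (by rw [hs, one_pow])) with rfl | rfl
  all_goals
    fin_cases m <;> fin_cases l <;> simp [rotation, meridionalField, invStereo] <;>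
      field_simp <;> unfold normSqSpatial <;> ring

theorem rotation_equatorial (s : ℝ) (p q : Fin 3) (x : Coord) :
    rotation p.castSucc q.castSucc (invStereo s x)
      = fderiv ℝ (invStereo s) x (equatorialField p q x) := by
  have hN := normSqSpatial_add_one_ne_zero x
  rw [fderiv_invStereo]
  refine Prod.ext (by simp [rotation, equatorialField, (Fin.succ_ne_zero _).symm]) ?_
  ext l
  fin_cases p <;> fin_cases q <;> fin_cases l <;> simp [rotation, equatorialField, invStereo] <;>
      field_simp <;> ring

theorem boost_equatorial (s b : ℝ) (m : Fin 3) (x : Coord) :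
    boost b m.castSucc (invStereo s x) = fderiv ℝ (invStereo s) x (boostField b m x) := by
  have hN := normSqSpatial_add_one_ne_zero x
  rw [fderiv_invStereo]
  refine Prod.ext ?_ ?_
  · fin_cases m <;> simp [boost, boostField, invStereo, div_eq_mul_inv]
  ext l
  fin_cases m <;> fin_cases l <;> simp [boost, boostField, invStereo] <;>
      field_simp <;> unfold normSqSpatial <;> ring

theorem boost_polar (hs : s ^ 2 = 1) (b : ℝ) (x : Coord) :
    boost b 3 (invStereo s x) = fderiv ℝ (invStereo s) x (s • radialBoostField b x) := by
  have hN := normSqSpatial_add_one_ne_zero x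
  rw [fderiv_invStereo]
  refine Prod.ext ?_ ?_
  · simp [boost, radialBoostField, invStereo]
    field_simp
    ring
  ext l
  rcases (eq_or_eq_neg_of_sq_eq_sq s 1 (by rw [hs, one_pow])) with rfl | rfl
  all_goals
    fin_cases l <;> simp [boost, radialBoostField, invStereo] <;>
      field_simp <;> unfold normSqSpatial <;> ring

theorem contDiff_normSqSpatial : ContDiff ℝ ∞ normSqSpatial := by
  unfold normSqSpatial; fun_prop

theorem contDiff_inv_normSqSpatial_add_one :
    ContDiff ℝ ∞ fun x : Coord => (normSqSpatial x + 1)⁻¹ :=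
  (contDiff_normSqSpatial.add contDiff_const).inv normSqSpatial_add_one_ne_zero

theorem contDiff_meridionalField (m : Fin 3) : ContDiff ℝ ∞ (meridionalField m) := by
  have := contDiff_normSqSpatial
  refine contDiff_pi.2 fun l => ?_
  unfold meridionalField
  split_ifs <;> fun_prop

theorem contDiff_equatorialField (p q : Fin 3) : ContDiff ℝ ∞ (equatorialField p q) := by
  refine contDiff_pi.2 fun l => ?_
  unfold equatorialField
  split_ifs <;> fun_prop

theorem contDiff_boostField (b : ℝ) (m : Fin 3) : ContDiff ℝ ∞ (boostField b m) := by
  have h1 := contDiff_normSqSpatial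
  have h2 := contDiff_inv_normSqSpatial_add_one
  refine contDiff_pi.2 fun l => ?_
  unfold boostField
  split_ifs <;> fun_prop

theorem contDiff_radialBoostField (b : ℝ) : ContDiff ℝ ∞ (radialBoostField b) := by
  have h2 := contDiff_inv_normSqSpatial_add_one
  refine contDiff_pi.2 fun l => ?_
  unfold radialBoostField
  split_ifs <;> fun_prop

/-- To be Killing it suffices to have the components `σ s • Y` in the chart that projects from
`(0, 0, 0, s)`, where `Y` solves the Killing equation of the metric, which is the same in both
charts. -/
theorem isKilling_of_smul {X : Ambient → Ambient} {Y : Coord → Coord} (σ : ℝ → ℝ)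
    (hY : ContDiff ℝ ∞ Y) (hX : ∀ s, s ^ 2 = 1 → ∀ x, X (invStereo s x)
      = fderiv ℝ (invStereo s) x (σ s • Y x))
    (hL : ∀ s : ℝ, s ^ 2 = 1 → ∀ x : Coord, x 0 ∈ I → ∀ i j,
      lieDerivMetric (metricComp R (invStereo s)) Y i j x = 0) : IsKilling I R X := by
  intro φ hφ
  obtain ⟨s, hs, rfl⟩ := exists_eq_invStereo_of_mem_params hφ
  refine ⟨fun x => σ s • Y x, (hY.const_smul (σ s)).contDiffOn, fun x _ => hX s hs x,
    fun x hx i j => ?_⟩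
  rw [lieDerivMetric_const_smul, hL s hs x hx, mul_zero]

theorem isKilling_meridional (hI : IsOpen I)
    (hR : ∀ r ∈ I, 0 < cos (r + b) ∧ R r = a / cos (r + b)) (m : Fin 3) :
    IsKilling I R (rotation 3 m.castSucc) :=
  isKilling_of_smul id (contDiff_meridionalField m) (fun _ hs x => rotation_meridional hs m x)
    fun _ hs _ hx => lieDerivMetric_meridionalField hI hR hs hx m

theorem isKilling_equatorial (hI : IsOpen I)
    (hR : ∀ r ∈ I, 0 < cos (r + b) ∧ R r = a / cos (r + b)) (p q : Fin 3) :
    IsKilling I R (rotation p.castSucc q.castSucc) :=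
  isKilling_of_smul 1 (contDiff_equatorialField p q)
    (fun s _ x => by simpa using rotation_equatorial s p q x)
    fun _ hs _ hx => lieDerivMetric_equatorialField hI hR hs hx p q

theorem isKilling_boost (hI : IsOpen I)
    (hR : ∀ r ∈ I, 0 < cos (r + b) ∧ R r = a / cos (r + b)) (k : Fin 4) :
    IsKilling I R (boost b k) := by
  induction k using Fin.lastCases with
  | last =>
    exact isKilling_of_smul (X := boost b 3) id (contDiff_radialBoostField b)
      (fun _ hs x => boost_polar hs b x)
      fun _ hs _ hx => lieDerivMetric_radialBoostField hI hR hs hx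
  | cast m =>
    exact isKilling_of_smul 1 (contDiff_boostField b m)
      (fun s _ x => by simpa using boost_equatorial s b m x)
      fun _ hs _ hx => lieDerivMetric_boostField hI hR hs hx m

theorem isKilling_rotations (hI : IsOpen I)
    (hR : ∀ r ∈ I, 0 < cos (r + b) ∧ R r = a / cos (r + b)) (k : Fin 6) :
    IsKilling I R (rotations k) := by
  fin_cases k
  exacts [isKilling_meridional hI hR 0, isKilling_meridional hI hR 1, isKilling_meridional hI hR 2,
    isKilling_equatorial hI hR 0 1, isKilling_equatorial hI hR 1 2, isKilling_equatorial hI hR 2 0]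

theorem hasComponents_rotations (I : Set ℝ) (k : Fin 6) :
    HasComponents I northParam (rotations k) (rotationField k) := by
  have hm (m : Fin 3) (x : Coord) : rotation 3 m.castSucc (northParam x)
      = fderiv ℝ northParam x (meridionalField m x) := by
    have h := rotation_meridional (one_pow 2) m x
    rwa [one_smul] at h
  have he (p q : Fin 3) (x : Coord) : rotation p.castSucc q.castSucc (northParam x)
      = fderiv ℝ northParam x (equatorialField p q x) := rotation_equatorial 1 p q x
  intro x _
  fin_cases k
  · refine (hm 0 x).trans (congrArg _ (funext fun l => ?_))
    fin_cases l <;> simp [rotationField, meridionalField]; ring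
  · refine (hm 1 x).trans (congrArg _ (funext fun l => ?_))
    fin_cases l <;> simp [rotationField, meridionalField]; ring
  · refine (hm 2 x).trans (congrArg _ (funext fun l => ?_))
    fin_cases l <;> simp [rotationField, meridionalField]; ring
  · refine (he 0 1 x).trans (congrArg _ (funext fun l => ?_))
    fin_cases l <;> simp [rotationField, equatorialField]
  · refine (he 1 2 x).trans (congrArg _ (funext fun l => ?_))
    fin_cases l <;> simp [rotationField, equatorialField]
  · refine (he 2 0 x).trans (congrArg _ (funext fun l => ?_))
    fin_cases l <;> simp [rotationField, equatorialField]

theorem fst_rotations (k : Fin 6) (z : Ambient) : (rotations k z).1 = 0 := by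
  fin_cases k <;> rfl

theorem metric_self_neg {p v : Ambient} (hRp : R p.1 ≠ 0) (hv : v.1 = 0) (hv0 : v ≠ 0) :
    metric R p v v < 0 := by
  have h2 : v.2 ≠ 0 := fun h => hv0 (Prod.ext hv h)
  rw [metric, hv, real_inner_self_eq_norm_sq]
  have := norm_pos_iff.2 h2
  have : 0 < R p.1 ^ 2 * ‖v.2‖ ^ 2 := by positivity
  linarith

theorem metric_self_nonpos {p v : Ambient} (hv : v.1 = 0) : metric R p v v ≤ 0 := by
  rw [metric, hv, real_inner_self_eq_norm_sq]
  have : 0 ≤ R p.1 ^ 2 * ‖v.2‖ ^ 2 := by positivity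
  linarith

/-! ### Linear combinations of the ten fields -/

theorem fst_sum_fields (α : Fin 6 ⊕ Fin 4 → ℝ) (b : ℝ) (p : Ambient) :
    (∑ k, α k • Sum.elim rotations (boost b) k p).1
      = cos (p.1 + b) * ∑ k, α (Sum.inr k) * p.2 k := by
  rw [Prod.fst_sum, Fintype.sum_sum_type]
  simp only [Sum.elim_inl, Sum.elim_inr, Prod.smul_fst, fst_rotations, mul_zero,
    Finset.sum_const_zero, zero_add, boost, smul_eq_mul, Finset.mul_sum]
  exact Finset.sum_congr rfl fun k _ => by ring

/-- The time component of a combination is a linear form in `y`, which has a zero on `S³`. -/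
theorem not_isPurelyTimelike_sum {r : ℝ} (hr : r ∈ I) (α : Fin 6 ⊕ Fin 4 → ℝ) :
    ¬ IsPurelyTimelike I R (fun p => ∑ k, α k • Sum.elim rotations (boost b) k p) := by
  intro h
  obtain ⟨y, hy, hy0⟩ : ∃ y : EuclideanSpace ℝ (Fin 4), ‖y‖ = 1 ∧
      ∑ k, α (Sum.inr k) * y k = 0 := by
    by_cases h0 : α (.inr 0) = 0
    · exact ⟨EuclideanSpace.single 0 1, by simp, by simp [h0]⟩
    -- With the first coefficient nonzero, a nonzero kernel vector lies in the plane of `y¹`, `y²`.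
    · set w : EuclideanSpace ℝ (Fin 4) := !₂[-α (.inr 1), α (.inr 0), 0, 0] with hw
      have hw0 : w ≠ 0 := fun h => h0 (by simpa [hw] using congr($h 1))
      refine ⟨‖w‖⁻¹ • w, norm_smul_inv_norm hw0, ?_⟩
      simp [Fin.sum_univ_four, hw]
      ring
  refine absurd (h (r, y) ⟨hr, hy⟩) (not_lt.2 (metric_self_nonpos ?_))
  simp only [fst_sum_fields, hy0, mul_zero]

/-- At a single time the time components, being linear forms in `y`, determine the coefficients of
the boosts; what remains is an element of `so(4)` that vanishes on the standard basis. -/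
theorem linearIndependent_fields {r : ℝ} (hr : r ∈ I) (hc : cos (r + b) ≠ 0) :
    LinearIndependent ℝ
      (fun (k : Fin 6 ⊕ Fin 4) (p : spacetime I) => Sum.elim rotations (boost b) k p.1) := by
  rw [Fintype.linearIndependent_iff]
  intro α hα
  have h (j : Fin 4) : ∑ k, α k • Sum.elim rotations (boost b) k (r, EuclideanSpace.single j 1)
      = 0 := by
    simpa using congrFun hα ⟨(r, EuclideanSpace.single j 1), hr, by simp⟩
  have hβ (j : Fin 4) : α (.inr j) = 0 := by
    have := fst_sum_fields α b (r, EuclideanSpace.single j 1)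
    rw [h j] at this
    simpa [hc] using this
  -- The coefficients of the rotations are the matrix entries of the resulting element of `so(4)`.
  have h' (j l : Fin 4) : ∑ k : Fin 6, α (.inl k) * (rotations k (r, EuclideanSpace.single j 1)).2 l
      = 0 := by
    have := congr(($(h j)).2 l)
    rw [Fintype.sum_sum_type] at this
    simpa [hβ, Prod.snd_sum] using this
  have h01 := h' 0 1
  have h02 := h' 0 2
  have h03 := h' 0 3
  have h12 := h' 1 2
  have h13 := h' 1 3
  have h23 := h' 2 3
  simp [Fin.sum_univ_six, rotations, rotation] at h01 h02 h03 h12 h13 h23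
  rintro (k | k)
  · fin_cases k <;> assumption
  · exact hβ k

end

/-! ### The embedding into de Sitter space -/

section

variable {I : Set ℝ} {R : ℝ → ℝ} {a b : ℝ} {T : ℝ → ℝ}

theorem fderiv_toMinkowski_apply (a : ℝ) {p : Ambient} {T' : ℝ} (hT : HasDerivAt T T' p.1)
    (v : Ambient) :
    fderiv ℝ (toMinkowski a T) p v
      = (a * cosh (T p.1) * T' * v.1,
        (a * sinh (T p.1) * T' * v.1) • p.2 + (a * cosh (T p.1)) • v.2) := by
  have h1 : HasFDerivAt (fun q : Ambient => T q.1)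
      (T' • ContinuousLinearMap.fst ℝ ℝ (EuclideanSpace ℝ (Fin 4))) p :=
    hT.comp_hasFDerivAt p hasFDerivAt_fst
  have h : HasFDerivAt (toMinkowski a T) _ p :=
    (h1.sinh.const_mul a).prodMk ((h1.cosh.const_mul a).smul hasFDerivAt_snd)
  rw [h.fderiv]
  refine Prod.ext ?_ ?_
  · simp
    ring
  · simp [add_comm, mul_assoc]

theorem sinh_eq_tan (hT : ∀ x ∈ I, T x = arsinh (tan (x + b))) {x : ℝ} (hx : x ∈ I) :
    sinh (T x) = tan (x + b) := by
  rw [hT x hx, sinh_arsinh]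

theorem cosh_eq_one_div_cos (hT : ∀ x ∈ I, T x = arsinh (tan (x + b))) {x : ℝ} (hx : x ∈ I)
    (hc : 0 < cos (x + b)) : cosh (T x) = 1 / cos (x + b) := by
  rw [hT x hx, cosh_arsinh_tan hc]

theorem hasDerivAt_of_eq_arsinh_tan (hI : IsOpen I) (hT : ∀ x ∈ I, T x = arsinh (tan (x + b)))
    {x : ℝ} (hx : x ∈ I) (hc : 0 < cos (x + b)) : HasDerivAt T (1 / cos (x + b)) x :=
  ((hasDerivAt_arsinh_tan hc).comp_add_const x b).congr_of_eventuallyEq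
    ((hI.eventually_mem hx).mono hT)

theorem fderiv_toMinkowski (hI : IsOpen I) (hT : ∀ x ∈ I, T x = arsinh (tan (x + b)))
    {p : Ambient} (hp : p.1 ∈ I) (hc : 0 < cos (p.1 + b)) (v : Ambient) :
    fderiv ℝ (toMinkowski a T) p v
      = (a / cos (p.1 + b) ^ 2 * v.1,
        (a * sin (p.1 + b) / cos (p.1 + b) ^ 2 * v.1) • p.2 + (a / cos (p.1 + b)) • v.2) := by
  rw [fderiv_toMinkowski_apply a (hasDerivAt_of_eq_arsinh_tan hI hT hp hc) v, sinh_eq_tan hT hp,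
    cosh_eq_one_div_cos hT hp hc, tan_eq_sin_div_cos]
  refine Prod.ext (by simp only []; field_simp) ?_
  congr 2 <;> field_simp

theorem minkowski_toMinkowski (a : ℝ) (T : ℝ → ℝ) {p : Ambient} (hp : ‖p.2‖ = 1) :
    minkowski (toMinkowski a T p) (toMinkowski a T p) = -a ^ 2 := by
  simp only [minkowski, toMinkowski, real_inner_smul_left, real_inner_smul_right]
  rw [real_inner_self_eq_norm_sq, hp]
  linear_combination (-a ^ 2) * cosh_sq (T p.1)

theorem isIsometricEmbedding_toMinkowski (hI : IsOpen I) (ha : 0 < a)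
    (hR : ∀ x ∈ I, x + b ∈ Ioo (-(π / 2)) (π / 2) ∧ R x = a / cos (x + b))
    (hT : ∀ x ∈ I, T x = arsinh (tan (x + b))) :
    IsIsometricEmbedding I R a (toMinkowski a T) where
  smooth := by
    have h : ContDiffOn ℝ ∞ T I := by
      refine ContDiffOn.congr (f := fun x => arsinh (tan (x + b))) (fun x hx => ?_) hT
      have hc := (cos_pos_of_mem_Ioo (hR x hx).1).ne'
      exact (((contDiffAt_tan.2 hc).comp x
        (contDiffAt_id.add contDiffAt_const)).arsinh).contDiffWithinAt
    have h1 : ContDiffOn ℝ ∞ (fun p : Ambient => T p.1) (I ×ˢ univ) :=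
      h.comp contDiff_fst.contDiffOn fun p hp => hp.1
    exact (contDiffOn_const.mul h1.sinh).prodMk
      ((contDiffOn_const.mul h1.cosh).smul contDiff_snd.contDiffOn)
  injOn := by
    intro p hp q hq h
    have h1 : a * sinh (T p.1) = a * sinh (T q.1) := congr(($h).1)
    have h2 : (a * cosh (T p.1)) • p.2 = (a * cosh (T q.1)) • q.2 := congr(($h).2)
    have h1' := mul_left_cancel₀ ha.ne' h1
    rw [sinh_inj.1 h1'] at h2
    rw [sinh_eq_tan hT hp.1, sinh_eq_tan hT hq.1] at h1'
    exact Prod.ext (add_right_cancel (injOn_tan (hR _ hp.1).1 (hR _ hq.1).1 h1'))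
      (smul_right_injective _ (mul_pos ha (cosh_pos _)).ne' h2)
  mapsTo := fun p hp => minkowski_toMinkowski a T hp.2
  isometric := by
    intro p hp v w hv hw
    have hc := cos_pos_of_mem_Ioo (hR _ hp.1).1
    have hw' : inner ℝ p.2 w.2 = 0 := hw
    have hv' : inner ℝ v.2 p.2 = 0 := (real_inner_comm _ _).trans hv
    simp only [fderiv_toMinkowski hI hT hp.1 hc, minkowski, metric, (hR _ hp.1).2, inner_add_left,
      inner_add_right, real_inner_smul_left, real_inner_smul_right, real_inner_self_eq_norm_sq,
      hp.2, hw', hv']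
    field_simp
    linear_combination (-v.1 * w.1) * sin_sq_add_cos_sq (p.1 + b)

theorem image_toMinkowski (I : Set ℝ) (ha : 0 < a) (T : ℝ → ℝ) :
    toMinkowski a T '' spacetime I = {z ∈ deSitter a | ∃ x ∈ I, z.1 = a * sinh (T x)} := by
  ext z
  constructor
  · rintro ⟨p, hp, rfl⟩
    exact ⟨minkowski_toMinkowski a T hp.2, p.1, hp.1, rfl⟩
  · rintro ⟨hz, x, hx, hzx⟩
    have hz : z.1 * z.1 - inner ℝ z.2 z.2 = -a ^ 2 := hz
    have hpos : 0 < a * cosh (T x) := mul_pos ha (cosh_pos _)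
    have hnorm : ‖z.2‖ = a * cosh (T x) := by
      refine (sq_eq_sq₀ (norm_nonneg _) hpos.le).1 ?_
      rw [real_inner_self_eq_norm_sq, hzx] at hz
      linear_combination -hz - a ^ 2 * cosh_sq (T x)
    refine ⟨(x, (a * cosh (T x))⁻¹ • z.2), ⟨hx, ?_⟩, Prod.ext hzx.symm ?_⟩
    · rw [norm_smul, hnorm, norm_inv, norm_of_nonneg hpos.le, inv_mul_cancel₀ hpos.ne']
    · exact smul_inv_smul₀ hpos.ne' z.2

theorem image_toMinkowski_eq_deSitter {I : Set ℝ} (ha : 0 < a) {c : ℝ} (hc : 0 < c) {t : ℝ → ℝ}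
    (t₀ : ℝ) (ht : t '' I = univ) :
    toMinkowski a (modifiedTime c t a t₀) '' spacetime I = deSitter a := by
  rw [image_toMinkowski I ha]
  refine sep_eq_self_iff_mem_true.2 fun z _ => ?_
  obtain ⟨x, hx, hxt⟩ : t₀ + a / c * arsinh (z.1 / a) ∈ t '' I := ht ▸ mem_univ _
  refine ⟨x, hx, ?_⟩
  have : modifiedTime c t a t₀ x = arsinh (z.1 / a) := by
    rw [modifiedTime, hxt]
    field_simp
    ring
  rw [this, sinh_arsinh]
  field_simp

/-- `toMinkowski` turns the fields `boost` into the hyperbolic rotations of Minkowski space. -/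
theorem fderiv_toMinkowski_boost (hI : IsOpen I) (hT : ∀ x ∈ I, T x = arsinh (tan (x + b)))
    {p : Ambient} (hp : p.1 ∈ I) (hc : 0 < cos (p.1 + b)) (k : Fin 4) :
    fderiv ℝ (toMinkowski a T) p (boost b k p) = hyperbolicRotation k (toMinkowski a T p) := by
  rw [fderiv_toMinkowski hI hT hp hc]
  simp only [boost, hyperbolicRotation, toMinkowski, sinh_eq_tan hT hp,
    cosh_eq_one_div_cos hT hp hc, tan_eq_sin_div_cos]
  refine Prod.ext ?_ ?_
  · simp
    field_simp
  · ext l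
    by_cases hl : l = k <;> simp [hl] <;> field_simp
    all_goals ring

/-- The components of the hyperbolic rotations, transformed to the coordinates `u`. -/
theorem hasComponents_boost (hI : IsOpen I) (hc : ∀ x ∈ I, 0 < cos (x + b))
    (hT : ∀ x ∈ I, T x = arsinh (tan (x + b))) (k : Fin 4) :
    ∃ Y : Coord → Coord, HasComponents I northParam (boost b k) Y ∧
      ∀ x : Coord, x 0 ∈ I → fderiv ℝ (modifiedCoord T) x (Y x)
        = hyperbolicField k (modifiedCoord T x) := by
  have hfd {x : Coord} (hx : x 0 ∈ I) (v : Coord) : fderiv ℝ (modifiedCoord T) x v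
      = ![1 / cos (x 0 + b) * v 0, v 1, v 2, v 3] := by
    have hp (l : Fin 4) := hasFDerivAt_apply (𝕜 := ℝ) (F' := fun _ : Fin 4 => ℝ) l x
    let P : Fin 4 → Coord →L[ℝ] ℝ := ContinuousLinearMap.proj
    have h : HasFDerivAt (modifiedCoord T) (ContinuousLinearMap.pi
        ![(1 / cos (x 0 + b)) • P 0, P 1, P 2, P 3]) x := by
      refine hasFDerivAt_pi.2 fun l => ?_
      fin_cases l
      exacts [(hasDerivAt_of_eq_arsinh_tan hI hT hx (hc _ hx)).comp_hasFDerivAt x (hp 0),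
        hp 1, hp 2, hp 3]
    rw [h.fderiv]
    ext l
    fin_cases l <;> simp [P]
  have htanh {x : Coord} (hx : x 0 ∈ I) : sinh (T (x 0)) / cosh (T (x 0)) = sin (x 0 + b) := by
    have := (hc _ hx).ne'
    rw [sinh_eq_tan hT hx, cosh_eq_one_div_cos hT hx (hc _ hx), tan_eq_sin_div_cos]
    field_simp
  have hn (x : Coord) : normSqSpatial (modifiedCoord T x) = normSqSpatial x := by
    simp [normSqSpatial, modifiedCoord]
  have hu (x : Coord) : modifiedCoord T x 0 = T (x 0) ∧ modifiedCoord T x 1 = x 1 ∧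
      modifiedCoord T x 2 = x 2 ∧ modifiedCoord T x 3 = x 3 := ⟨rfl, rfl, rfl, rfl⟩
  induction k using Fin.lastCases with
  | last =>
    refine ⟨radialBoostField b, fun x _ => ?_, fun x hx => ?_⟩
    · have h := boost_polar (one_pow 2) b x
      rwa [one_smul] at h
    · have := (hc _ hx).ne'
      have hN := normSqSpatial_add_one_ne_zero x
      rw [hfd hx]
      ext l
      fin_cases l <;> simp [hyperbolicField, radialBoostField, htanh hx, hn, hu]
      · field_simp
        ring
      all_goals field_simp
  | cast m =>
    refine ⟨boostField b m, fun x _ => boost_equatorial 1 b m x, fun x hx => ?_⟩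
    have := (hc _ hx).ne'
    have hN := normSqSpatial_add_one_ne_zero x
    rw [hfd hx]
    ext l
    fin_cases m <;> fin_cases l <;> simp [hyperbolicField, boostField, htanh hx, hn, hu] <;>
      field_simp <;> ring

end
end ClosedUniverse

theorem theorem6p2
    (I : Set ℝ) (hI_open : IsOpen I) (hI_conn : I.OrdConnected) (hI_ne : I.Nonempty)
    (R : ℝ → ℝ) (hR : ContDiffOn ℝ 2 R I) (hR_pos : ∀ x ∈ I, 0 < R x)
    (hODE : ∀ x ∈ I, 2 * deriv R x ^ 2 - deriv (deriv R) x * R x + R x ^ 2 = 0)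
    (c : ℝ) (hc : 0 < c)
    (t : ℝ → ℝ) (ht : ∀ x ∈ I, HasDerivAt t (R x / c) x) :
    ∃ a b t₀ : ℝ, 0 < a ∧
      (∀ x ∈ I, x + b ∈ Ioo (-(π / 2)) (π / 2) ∧ R x = a / cos (x + b)) ∧
      (∀ x ∈ I, R x = a * cosh (c * (t x - t₀) / a)) ∧
      HasConstantCurvature I R (-1 / a ^ 2) ∧
      -- the space-time is a time slab of de Sitter space, and all of it if `t` takes all values
      IsIsometricEmbedding I R a (toMinkowski a (modifiedTime c t a t₀)) ∧
      toMinkowski a (modifiedTime c t a t₀) '' spacetime I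
        = {z ∈ deSitter a | ∃ x ∈ I, z.1 = a * sinh (modifiedTime c t a t₀ x)} ∧
      (t '' I = univ → toMinkowski a (modifiedTime c t a t₀) '' spacetime I = deSitter a) ∧
      -- the ten Killing vector fields
      ∃ (K : Fin 6 → Ambient → Ambient) (H : Fin 4 → Ambient → Ambient),
        (∀ k, HasComponents I northParam (K k) (rotationField k)) ∧
        (∀ k, ∃ Y : Coord → Coord, HasComponents I northParam (H k) Y ∧
          ∀ x : Coord, x 0 ∈ I →
            fderiv ℝ (modifiedCoord (modifiedTime c t a t₀)) x (Y x)
              = hyperbolicField k (modifiedCoord (modifiedTime c t a t₀) x)) ∧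
        (∀ k, ∀ p ∈ spacetime I,
          fderiv ℝ (toMinkowski a (modifiedTime c t a t₀)) p (H k p)
            = hyperbolicRotation k (toMinkowski a (modifiedTime c t a t₀) p)) ∧
        (∀ k, IsKilling I R (K k) ∧ IsSpacelike I R (K k)) ∧
        (∀ k, IsKilling I R (H k)) ∧
        LinearIndependent ℝ
          (fun (k : Fin 6 ⊕ Fin 4) (p : spacetime I) => Sum.elim K H k p.1) ∧
        ∀ α : Fin 6 ⊕ Fin 4 → ℝ,
          ¬ IsPurelyTimelike I R (fun p => ∑ k, α k • Sum.elim K H k p) := by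
  obtain ⟨a, b, ha, hRab⟩ := exists_eq_div_cos hI_open hI_conn hI_ne hR hR_pos hODE
  obtain ⟨t₀, hT⟩ := exists_modifiedTime_eq hI_open hI_conn hI_ne ha hc hRab ht
  have hcos : ∀ x ∈ I, 0 < cos (x + b) := fun x hx => cos_pos_of_mem_Ioo (hRab x hx).1
  have hRcos : ∀ x ∈ I, 0 < cos (x + b) ∧ R x = a / cos (x + b) := fun x hx =>
    ⟨hcos x hx, (hRab x hx).2⟩
  obtain ⟨r, hr⟩ := hI_ne
  refine ⟨a, b, t₀, ha, hRab, fun x hx => ?_, hasConstantCurvature hI_open ha.ne' hRcos,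
    isIsometricEmbedding_toMinkowski hI_open ha hRab hT, image_toMinkowski I ha _,
    image_toMinkowski_eq_deSitter ha hc t₀, rotations, boost b, hasComponents_rotations I,
    hasComponents_boost hI_open hcos hT,
    fun k p hp => fderiv_toMinkowski_boost hI_open hT hp.1 (hcos _ hp.1) k,
    fun k => ⟨isKilling_rotations hI_open hRcos k, fun p hp h0 =>
      metric_self_neg (hR_pos _ hp.1).ne' (fst_rotations k p) h0⟩,
    isKilling_boost hI_open hRcos, linearIndependent_fields hr (hcos r hr).ne',
    not_isPurelyTimelike_sum hr⟩
  rw [(hRab x hx).2, ← mul_one_div, ← cosh_eq_one_div_cos hT hx (hcos x hx), modifiedTime]
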